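/- Let $0\le k\le N$ be integers, let $\mathcal R_{N,k}$ be the set of complex $N\times N$ matrices of rank at most $k$, and let $\mathcal R^d_{N,k}\subset\mathcal R_{N,k}$ be the subset of those matrices $A$ whose singular values, in decreasing order and counted with multiplicity, satisfy $\sigma_1(A)>\sigma_2(A)>\dots>\sigma_k(A)>0$ (so that $A$ has rank exactly $k$ and its nonzero singular values are distinct). Regard the space of complex $N\times N$ matrices as a real vector space of dimension $2N^2$ with the Frobenius norm. (i) $\mathcal R^d_{N,k}$ is a smooth (embedded) submanifold of this space, of real dimension $2(2Nk-k^2)$. (ii) $\mathcal R_{N,k}=\overline{\mathcal R^d_{N,k}}$. (iii) $\mathcal R_{N,k}\setminus\mathcal R^d_{N,k}$ is thin relatively to $\mathcal R_{N,k}$, that is, it is contained in the union of finitely many smooth embedded submanifolds of the space of matrices, each of real dimension strictly less than $2(2Nk-k^2)$. -/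

import Mathlib

open scoped ContDiff

-- The space of complex matrices carries the Frobenius norm.
attribute [local instance] Matrix.frobeniusNormedAddCommGroup Matrix.frobeniusNormedSpace

/-- `M` is a `d`-dimensional smooth (embedded) submanifold of the real normed space `E`: around each
of its points there is a smooth diffeomorphism `φ` between open subsets of `E` which carries `M` to
the part of a `d`-dimensional linear subspace `W` lying in the target of `φ`
(`φ.IsImage M W` says that `φ x ∈ W ↔ x ∈ M` for all `x` in the source of `φ`). -/
def IsSmoothSubmanifold {E : Type*} [NormedAddCommGroup E] [NormedSpace ℝ E]
    (M : Set E) (d : ℕ) : Prop :=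
  ∀ p ∈ M, ∃ (φ : OpenPartialHomeomorph E E) (W : Submodule ℝ E),
    p ∈ φ.source ∧
    ContDiffOn ℝ ∞ φ φ.source ∧
    ContDiffOn ℝ ∞ φ.symm φ.target ∧
    FiniteDimensional ℝ W ∧
    Module.finrank ℝ W = d ∧
    φ.IsImage M (W : Set E)

/-- `S` is thin relatively to a (generically) `D`-dimensional set: it is contained in the union of
finitely many submanifolds of dimension lower than `D`. -/
def IsThinRel {E : Type*} [NormedAddCommGroup E] [NormedSpace ℝ E]
    (S : Set E) (D : ℕ) : Prop :=
  ∃ (n : ℕ) (M : Fin n → Set E) (d : Fin n → ℕ),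
    (∀ i, d i < D ∧ IsSmoothSubmanifold (M i) (d i)) ∧ S ⊆ ⋃ i, M i

/-- The set of complex `N × N` matrices of rank at most `k`. -/
def rankAtMost (N k : ℕ) : Set (Matrix (Fin N) (Fin N) ℂ) :=
  {A | A.rank ≤ k}

/-- The `i`-th singular value of `A` in decreasing order, with multiplicity, counted from `i = 0`. -/
noncomputable def singVal {N : ℕ} (A : Matrix (Fin N) (Fin N) ℂ) (i : ℕ) : ℝ :=
  (Matrix.toEuclideanLin A).singularValues i

/-- The set of complex `N × N` matrices of rank at most `k` whose first `k` singular values satisfy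
`σ₁ > σ₂ > ⋯ > σₖ > 0`; such a matrix has rank exactly `k`. -/
def rankDistinct (N k : ℕ) : Set (Matrix (Fin N) (Fin N) ℂ) :=
  {A | A ∈ rankAtMost N k ∧
    (∀ i j : ℕ, i < j → j < k → singVal A j < singVal A i) ∧
    (∀ i : ℕ, i < k → 0 < singVal A i)}

/-! Both conditions become simple in suitable coordinates. If a matrix `[X, B; C, D]`, after
reordering rows and columns, has an invertible `k × k` block `X`, then `(X, C X⁻¹, X⁻¹ B, D - C X⁻¹
B)` are smooth coordinates, and rank at most `k` means that the Schur complement vanishes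
(`schurCoord_snd_eq_zero_iff`). So the rank `k` matrices are locally a linear slice of real
dimension `2(k² + 2k(N - k)) = 2(2Nk - k²)`.

Among matrices of rank at most `k`, having `k` distinct positive singular values is the nonvanishing
of one real polynomial, `hankelDet`. It equals `∏ sᵢ ∏_{i<j} (sᵢ - sⱼ)²` with `sᵢ = σᵢ²`
(`mem_rankDistinct_iff`). The condition is open, which gives (i).

For (ii), rank at most `k` means `A = B C` with inner dimension `k`, and `hankelDet k (B C)` is a
nonzero polynomial on a vector space, hence nonzero on a dense set; closedness comes from minors.

For (iii), the matrices of rank `j < k` lie in finitely many slices of smaller dimension. Those of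
rank `k` with `hankelDet` zero form, in each chart, the zero set of a nonzero polynomial, which is
thin by induction on the degree (`isThinRel_eval_coord_eq_zero`). -/

/-! ### Submanifolds, thin sets and their transport along diffeomorphisms -/

section Submanifold

open Set Module

variable {E F G H : Type*} [NormedAddCommGroup E] [NormedSpace ℝ E] [NormedAddCommGroup F]
  [NormedSpace ℝ F] [NormedAddCommGroup G] [NormedSpace ℝ G] [NormedAddCommGroup H]
  [NormedSpace ℝ H]

/-- Submanifold charts may take values in any normed space isomorphic to the ambient one. -/
theorem isSmoothSubmanifold_of_charts [FiniteDimensional ℝ F] (e : F ≃ₗ[ℝ] E) {M : Set E} {d : ℕ}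
    (h : ∀ p ∈ M, ∃ (φ : OpenPartialHomeomorph E F) (W : Submodule ℝ F),
      p ∈ φ.source ∧ ContDiffOn ℝ ∞ φ φ.source ∧ ContDiffOn ℝ ∞ φ.symm φ.target ∧
      FiniteDimensional ℝ W ∧ finrank ℝ W = d ∧ φ.IsImage M (W : Set F)) :
    IsSmoothSubmanifold M d := by
  intro p hp
  have : FiniteDimensional ℝ E := e.finiteDimensional
  let L : F ≃L[ℝ] E := e.toContinuousLinearEquiv
  obtain ⟨φ, W, hpφ, hφ, hφ', hW, hWd, himg⟩ := h p hp
  refine ⟨φ.transHomeomorph L.toHomeomorph, W.map (L.toLinearEquiv : F →ₗ[ℝ] E), hpφ, ?_, ?_,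
    inferInstance, ?_, ?_⟩
  · exact L.contDiff.comp_contDiffOn hφ
  · exact hφ'.comp L.symm.contDiff.contDiffOn fun x hx => hx
  · rw [← hWd]; exact LinearEquiv.finrank_map_eq L.toLinearEquiv W
  · intro x hx
    have := himg hx
    rw [← this]
    change L (φ x) ∈ W.map (L.toLinearEquiv : F →ₗ[ℝ] E) ↔ φ x ∈ W
    constructor
    · rintro ⟨y, hy, hyx⟩
      have : y = φ x := L.injective hyx
      exact this ▸ hy
    · intro hy
      exact ⟨_, hy, rfl⟩

/-- The part of the preimage of a submanifold under a diffeomorphism between open sets. -/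
theorem IsSmoothSubmanifold.preimage [FiniteDimensional ℝ F] (L : F ≃ₗ[ℝ] E) {M : Set F} {d : ℕ}
    (hM : IsSmoothSubmanifold M d) (φ : OpenPartialHomeomorph E F)
    (hφ : ContDiffOn ℝ ∞ φ φ.source) (hφ' : ContDiffOn ℝ ∞ φ.symm φ.target) :
    IsSmoothSubmanifold (φ.source ∩ φ ⁻¹' M) d := by
  refine isSmoothSubmanifold_of_charts L ?_
  rintro p ⟨hp, hpM⟩
  obtain ⟨ψ, W, hpψ, hψ, hψ', hW, hWd, himg⟩ := hM _ hpM
  refine ⟨φ.trans ψ, W, ?_, ?_, ?_, hW, hWd, ?_⟩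
  · simp only [OpenPartialHomeomorph.trans_source]; exact ⟨hp, hpψ⟩
  · rw [OpenPartialHomeomorph.trans_source]
    exact hψ.comp (hφ.mono inter_subset_left) fun x hx => hx.2
  · rw [OpenPartialHomeomorph.trans_target]
    exact hφ'.comp (hψ'.mono inter_subset_left) fun x hx => hx.2
  · intro x hx
    rw [OpenPartialHomeomorph.trans_source] at hx
    have := himg hx.2
    simp only [OpenPartialHomeomorph.coe_trans, Function.comp_apply, mem_inter_iff, mem_preimage,
      hx.1, true_and]
    exact this

/-- The product of a chart with the identity straightens the set. This lifts strata in the block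
coordinates to the slice with zero Schur complement. -/
theorem IsSmoothSubmanifold.prod_zero {M : Set G} {d : ℕ} (hM : IsSmoothSubmanifold M d) :
    IsSmoothSubmanifold (M ×ˢ ({0} : Set H)) d := by
  rintro ⟨p, z⟩ ⟨hp, -⟩
  obtain ⟨ψ, W, hpψ, hψ, hψ', hW, hWd, himg⟩ := hM _ hp
  let e : (W.prod (⊥ : Submodule ℝ H)) ≃ₗ[ℝ] W :=
    { toFun := fun x => ⟨x.1.1, x.2.1⟩
      invFun := fun x => ⟨(x.1, 0), x.2, rfl⟩
      map_add' := fun _ _ => rfl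
      map_smul' := fun _ _ => rfl
      left_inv := by
        rintro ⟨⟨a, b⟩, ha, hb⟩
        simp [show b = 0 from hb]
      right_inv := fun _ => rfl }
  refine ⟨ψ.prod (OpenPartialHomeomorph.refl H), W.prod ⊥, ⟨hpψ, mem_univ _⟩, ?_, ?_,
    e.symm.finiteDimensional, e.finrank_eq.trans hWd, ?_⟩
  · exact ContDiffOn.prodMk (hψ.comp contDiff_fst.contDiffOn fun x hx => hx.1)
      contDiff_snd.contDiffOn
  · exact ContDiffOn.prodMk (hψ'.comp contDiff_fst.contDiffOn fun x hx => hx.1)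
      contDiff_snd.contDiffOn
  · rintro ⟨x, y⟩ hx
    have := himg hx.1
    change (ψ x ∈ W ∧ y ∈ (⊥ : Submodule ℝ H)) ↔ (x ∈ M ∧ y = 0)
    rw [Submodule.mem_bot]
    exact and_congr_left fun _ => this

/-- The inverse function theorem in the form of a smooth diffeomorphism between open sets. -/
theorem exists_openPartialHomeomorph_of_hasFDerivAt_equiv [CompleteSpace E] {ψ : E → E}
    (hψ : ContDiff ℝ ∞ ψ) {p : E} {A : E ≃L[ℝ] E} (hA : HasFDerivAt ψ (A : E →L[ℝ] E) p) :
    ∃ φ : OpenPartialHomeomorph E E, (φ : E → E) = ψ ∧ p ∈ φ.source ∧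
      ContDiffOn ℝ ∞ φ φ.source ∧ ContDiffOn ℝ ∞ φ.symm φ.target := by
  have h0 : (∞ : WithTop ℕ∞) ≠ 0 := by simp
  -- Restricting to points with invertible derivative makes the inverse smooth on the whole target,
  -- not only near the image of `p`.
  have hopen : IsOpen {x | fderiv ℝ ψ x ∈ range ((↑) : (E ≃L[ℝ] E) → E →L[ℝ] E)} :=
    (ContinuousLinearEquiv.isOpen (𝕜 := ℝ)).preimage (hψ.continuous_fderiv h0)
  let φ := ((hψ.contDiffAt (x := p)).toOpenPartialHomeomorph ψ hA h0).restrOpen _ hopen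
  have hsrc : ∀ x ∈ φ.source, fderiv ℝ ψ x ∈ range ((↑) : (E ≃L[ℝ] E) → E →L[ℝ] E) :=
    fun x hx => hx.2
  refine ⟨φ, rfl, ⟨ContDiffAt.mem_toOpenPartialHomeomorph_source _ hA h0, ?_⟩, hψ.contDiffOn, ?_⟩
  · exact ⟨A, hA.fderiv.symm⟩
  · intro y hy
    obtain ⟨B, hB⟩ := hsrc _ (φ.map_target hy)
    have hd : HasFDerivAt φ (B : E →L[ℝ] E) (φ.symm y) := by
      rw [hB]; exact ((hψ.differentiable h0) _).hasFDerivAt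
    exact (φ.contDiffAt_symm hy hd hψ.contDiffAt).contDiffWithinAt

/-- A regular level set of codimension one. -/
theorem isSmoothSubmanifold_level [FiniteDimensional ℝ G] {g : G → ℝ} (hg : ContDiff ℝ ∞ g)
    (v : G) : IsSmoothSubmanifold {x | g x = 0 ∧ fderiv ℝ g x v ≠ 0} (finrank ℝ G - 1) := by
  rintro p ⟨hp, hpv⟩
  have h0 : (∞ : WithTop ℕ∞) ≠ 0 := by simp
  have : CompleteSpace G := FiniteDimensional.complete ℝ G
  set w : G := (fderiv ℝ g p v)⁻¹ • v
  set l : G →L[ℝ] ℝ := fderiv ℝ g p with hl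
  have hlw : l w = 1 := by
    rw [show w = (l v)⁻¹ • v from rfl, map_smul, smul_eq_mul, inv_mul_cancel₀ hpv]
  -- As `l w = 1`, this choice gives `l (ψ x) = g x`, so `ψ` carries the level set into `ker l`; its
  -- derivative at `p` is the identity.
  let ψ : G → G := fun x => x + (g x - l x) • w
  have hψ : ContDiff ℝ ∞ ψ := contDiff_id.add ((hg.sub l.contDiff).smul contDiff_const)
  have hA : HasFDerivAt ψ ((ContinuousLinearEquiv.refl ℝ G : G ≃L[ℝ] G) : G →L[ℝ] G) p := by
    have h1 : HasFDerivAt g l p := (hg.differentiable h0 p).hasFDerivAt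
    have h2 := (hasFDerivAt_id (𝕜 := ℝ) p).add ((h1.sub l.hasFDerivAt).smul_const w)
    refine h2.congr_fderiv ?_
    ext x
    simp
  obtain ⟨φ, hφψ, hpφ, hφ, hφ'⟩ := exists_openPartialHomeomorph_of_hasFDerivAt_equiv hψ hA
  have hopen : IsOpen {x | fderiv ℝ g x v ≠ 0} :=
    isOpen_ne_fun ((hg.continuous_fderiv h0).clm_apply continuous_const) continuous_const
  refine ⟨φ.restrOpen _ hopen, LinearMap.ker (l : G →ₗ[ℝ] ℝ), ⟨hpφ, hpv⟩, ?_, ?_, inferInstance,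
    ?_, ?_⟩
  · exact hφ.mono inter_subset_left
  · exact hφ'.mono fun x hx => hx.1
  · have h1 := (l : G →ₗ[ℝ] ℝ).finrank_range_add_finrank_ker
    have h2 : LinearMap.range (l : G →ₗ[ℝ] ℝ) = ⊤ := by
      rw [LinearMap.range_eq_top]
      intro c
      exact ⟨c • w, by simp [hlw]⟩
    rw [h2, finrank_top, finrank_self] at h1
    omega
  · intro x hx
    have hxv : fderiv ℝ g x v ≠ 0 := hx.2
    change l (φ x) = 0 ↔ (g x = 0 ∧ fderiv ℝ g x v ≠ 0)
    rw [hφψ]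
    simp [ψ, hlw, hxv]

theorem IsThinRel.mono {S T : Set E} {D : ℕ} (h : IsThinRel T D) (hST : S ⊆ T) :
    IsThinRel S D := by
  obtain ⟨n, M, d, hM, hT⟩ := h
  exact ⟨n, M, d, hM, hST.trans hT⟩

theorem isThinRel_empty (D : ℕ) : IsThinRel (∅ : Set E) D :=
  ⟨0, Fin.elim0, Fin.elim0, fun i => i.elim0, empty_subset _⟩

theorem IsSmoothSubmanifold.isThinRel {M : Set E} {d D : ℕ} (hM : IsSmoothSubmanifold M d)
    (hd : d < D) : IsThinRel M D :=
  ⟨1, fun _ => M, fun _ => d, fun _ => ⟨hd, hM⟩, fun _ hx => mem_iUnion.2 ⟨0, hx⟩⟩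

theorem IsThinRel.union {S T : Set E} {D : ℕ} (hS : IsThinRel S D) (hT : IsThinRel T D) :
    IsThinRel (S ∪ T) D := by
  obtain ⟨m, M, d, hM, hSM⟩ := hS
  obtain ⟨n, M', d', hM', hTM⟩ := hT
  refine ⟨m + n, Fin.append M M', Fin.append d d', fun i => ?_, ?_⟩
  · refine Fin.addCases (fun i => ?_) (fun i => ?_) i
    · simpa using hM i
    · simpa using hM' i
  · rintro x (hx | hx)
    · obtain ⟨i, hi⟩ := mem_iUnion.1 (hSM hx)
      exact mem_iUnion.2 ⟨Fin.castAdd n i, by simpa using hi⟩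
    · obtain ⟨i, hi⟩ := mem_iUnion.1 (hTM hx)
      exact mem_iUnion.2 ⟨Fin.natAdd m i, by simpa using hi⟩

theorem IsThinRel.iUnion {ι : Type*} [Finite ι] {S : ι → Set E} {D : ℕ}
    (h : ∀ i, IsThinRel (S i) D) : IsThinRel (⋃ i, S i) D := by
  classical
  cases nonempty_fintype ι
  have : ∀ s : Finset ι, IsThinRel (⋃ i ∈ s, S i) D := by
    intro s
    induction s using Finset.induction_on with
    | empty => simpa using isThinRel_empty D
    | insert a s _ ih => rw [Finset.set_biUnion_insert]; exact (h a).union ih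
  simpa using this Finset.univ

theorem IsThinRel.preimage [FiniteDimensional ℝ F] (L : F ≃ₗ[ℝ] E) {S : Set F} {D : ℕ} (hS : IsThinRel S D)
    (φ : OpenPartialHomeomorph E F) (hφ : ContDiffOn ℝ ∞ φ φ.source)
    (hφ' : ContDiffOn ℝ ∞ φ.symm φ.target) : IsThinRel (φ.source ∩ φ ⁻¹' S) D := by
  obtain ⟨n, M, d, hM, hSM⟩ := hS
  refine ⟨n, fun i => φ.source ∩ φ ⁻¹' M i, d,
    fun i => ⟨(hM i).1, (hM i).2.preimage L φ hφ hφ'⟩, ?_⟩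
  rintro x ⟨hx, hxS⟩
  obtain ⟨i, hi⟩ := mem_iUnion.1 (hSM hxS)
  exact mem_iUnion.2 ⟨i, hx, hi⟩

theorem IsThinRel.prod_zero {S : Set G} {D : ℕ} (hS : IsThinRel S D) :
    IsThinRel (S ×ˢ ({0} : Set H)) D := by
  obtain ⟨n, M, d, hM, hSM⟩ := hS
  refine ⟨n, fun i => M i ×ˢ {0}, d, fun i => ⟨(hM i).1, (hM i).2.prod_zero⟩, ?_⟩
  rintro x ⟨hx, hx0⟩
  obtain ⟨i, hi⟩ := mem_iUnion.1 (hSM hx)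
  exact mem_iUnion.2 ⟨i, hi, hx0⟩

/-- A diffeomorphism between the open sets `{a ≠ 0}` and `{b ≠ 0}`. -/
def openPartialHomeomorphOfContDiffOn {f : E → F} {g : F → E} {a : E → ℂ} {b : F → ℂ}
    (ha : ContDiff ℝ ∞ a) (hb : ContDiff ℝ ∞ b) (hf : ContDiffOn ℝ ∞ f {x | a x ≠ 0})
    (hg : ContDiffOn ℝ ∞ g {y | b y ≠ 0}) (hfm : ∀ x, a x ≠ 0 → b (f x) ≠ 0)
    (hgm : ∀ y, b y ≠ 0 → a (g y) ≠ 0) (hgf : ∀ x, a x ≠ 0 → g (f x) = x)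
    (hfg : ∀ y, b y ≠ 0 → f (g y) = y) : OpenPartialHomeomorph E F where
  toFun := f
  invFun := g
  source := {x | a x ≠ 0}
  target := {y | b y ≠ 0}
  map_source' := hfm
  map_target' := hgm
  left_inv' := hgf
  right_inv' := hfg
  open_source := isOpen_ne_fun ha.continuous continuous_const
  open_target := isOpen_ne_fun hb.continuous continuous_const
  continuousOn_toFun := hf.continuousOn
  continuousOn_invFun := hg.continuousOn

end Submanifold

/-! ### Real polynomial functions: thin zero sets and dense complements -/

section PolynomialFunctions

open Set Module

/-- Each monomial `m` of the derivative comes from the monomial `m + eᵢ` of `p`. -/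
theorem MvPolynomial.totalDegree_pderiv_lt {σ R : Type*} [CommRing R] {p : MvPolynomial σ R}
    (i : σ) (hp : MvPolynomial.pderiv i p ≠ 0) :
    (MvPolynomial.pderiv i p).totalDegree < p.totalDegree := by
  classical
  have key : ∀ m ∈ (MvPolynomial.pderiv i p).support,
      (m.sum fun _ e => e) + 1 ≤ p.totalDegree := by
    intro m hm
    have h1 : m + Finsupp.single i 1 ∈ p.support := by
      rw [MvPolynomial.mem_support_iff] at hm ⊢
      intro h0
      apply hm
      rw [MvPolynomial.coeff_pderiv, h0, zero_mul]
    have h2 := MvPolynomial.le_totalDegree h1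
    rw [Finsupp.sum_add_index' (fun _ => rfl) (fun _ _ _ => rfl),
      Finsupp.sum_single_index rfl] at h2
    exact h2
  obtain ⟨m, hm⟩ := MvPolynomial.support_nonempty.2 hp
  have hpos := key m hm
  rw [MvPolynomial.totalDegree, Finset.sup_lt_iff (by simp; omega)]
  exact fun m hm => key m hm

/-- A coefficient at `m` with `m i ≠ 0` reappears in the `i`-th derivative multiplied by `m i`,
which is nonzero in characteristic zero. -/
theorem MvPolynomial.eq_C_of_pderiv_eq_zero {σ R : Type*} [CommRing R] [IsDomain R] [CharZero R]
    {p : MvPolynomial σ R} (h : ∀ i, MvPolynomial.pderiv i p = 0) :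
    p = MvPolynomial.C (MvPolynomial.coeff 0 p) := by
  classical
  ext m
  rw [MvPolynomial.coeff_C]
  split_ifs with hm
  · rw [hm]
  · obtain ⟨i, hi⟩ : ∃ i, m i ≠ 0 := by
      by_contra! hc
      exact hm (Finsupp.ext fun i => (hc i).symm)
    have h1 := congrArg (MvPolynomial.coeff (m - Finsupp.single i 1)) (h i)
    have h2 : m - Finsupp.single i 1 + Finsupp.single i 1 = m :=
      tsub_add_cancel_of_le (by simpa using Nat.one_le_iff_ne_zero.2 hi)
    rw [MvPolynomial.coeff_pderiv, h2, MvPolynomial.coeff_zero] at h1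
    refine (mul_eq_zero.1 h1).resolve_right ?_
    exact Nat.cast_add_one_ne_zero _

variable (G : Type*) [NormedAddCommGroup G] [NormedSpace ℝ G] [FiniteDimensional ℝ G]

/-- Real polynomial functions on a finite-dimensional real normed space. -/
noncomputable def polyFun : Subalgebra ℝ (G → ℝ) :=
  (MvPolynomial.aeval fun (i : Fin (finrank ℝ G)) (x : G) => (finBasis ℝ G).coord i x).range

variable {G}

theorem mem_polyFun_iff {f : G → ℝ} : f ∈ polyFun G ↔
    ∃ p : MvPolynomial (Fin (finrank ℝ G)) ℝ,
      f = fun x => MvPolynomial.eval (fun i => (finBasis ℝ G).coord i x) p := by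
  have : ∀ p : MvPolynomial (Fin (finrank ℝ G)) ℝ,
      MvPolynomial.aeval (fun i (x : G) => (finBasis ℝ G).coord i x) p =
        fun x => MvPolynomial.eval (fun i => (finBasis ℝ G).coord i x) p := by
    intro p
    induction p using MvPolynomial.induction_on with
    | C a => ext x; simp
    | add p q hp hq => ext x; rw [map_add, hp, hq]; simp
    | mul_X p i hp => ext x; rw [map_mul, hp]; simp
  constructor
  · rintro ⟨p, rfl⟩
    exact ⟨p, this p⟩
  · rintro ⟨p, rfl⟩
    exact ⟨p, this p⟩

theorem linearMap_mem_polyFun (l : G →ₗ[ℝ] ℝ) : (l : G → ℝ) ∈ polyFun G := by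
  have : (l : G → ℝ) = ∑ i, l (finBasis ℝ G i) • fun x => (finBasis ℝ G).coord i x := by
    ext x
    conv_lhs => rw [← (finBasis ℝ G).sum_repr x, map_sum]
    simp [mul_comm]
  rw [this]
  refine Subalgebra.sum_mem _ fun i _ => Subalgebra.smul_mem _ ?_ _
  exact ⟨MvPolynomial.X i, by simp⟩

theorem hasFDerivAt_eval_coord (p : MvPolynomial (Fin (finrank ℝ G)) ℝ) (x : G) :
    HasFDerivAt (fun x => MvPolynomial.eval (fun i => (finBasis ℝ G).coord i x) p)
      (∑ i, MvPolynomial.eval (fun i => (finBasis ℝ G).coord i x) (MvPolynomial.pderiv i p) •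
        LinearMap.toContinuousLinearMap ((finBasis ℝ G).coord i)) x := by
  induction p using MvPolynomial.induction_on with
  | C a => simpa using hasFDerivAt_const a x
  | add p q hp hq =>
    simp only [map_add, add_smul, Finset.sum_add_distrib]
    exact hp.add hq
  | mul_X p i hp =>
    have h1 : HasFDerivAt (fun x => (finBasis ℝ G).coord i x)
        (LinearMap.toContinuousLinearMap ((finBasis ℝ G).coord i)) x :=
      (LinearMap.toContinuousLinearMap ((finBasis ℝ G).coord i)).hasFDerivAt
    have h2 := hp.mul h1
    simp only [map_mul, MvPolynomial.eval_X]
    refine h2.congr_fderiv ?_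
    simp only [Derivation.leibniz, MvPolynomial.pderiv_X, smul_eq_mul, map_add, map_mul,
      MvPolynomial.eval_X, add_smul, Finset.sum_add_distrib, Pi.single_apply, mul_ite, mul_one,
      mul_zero]
    congr 1
    · rw [Finset.sum_eq_single i (by intro j _ hj; simp [hj.symm]) (by simp)]
      simp
    · rw [Finset.smul_sum]
      simp [mul_smul]

theorem contDiff_eval_coord (p : MvPolynomial (Fin (finrank ℝ G)) ℝ) :
    ContDiff ℝ ∞ (fun x : G => MvPolynomial.eval (fun i => (finBasis ℝ G).coord i x) p) := by
  induction p using MvPolynomial.induction_on with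
  | C a => simpa using contDiff_const
  | add p q hp hq => simpa using hp.add hq
  | mul_X p i hp =>
    have h1 := (LinearMap.toContinuousLinearMap ((finBasis ℝ G).coord i)).contDiff (n := ∞)
    simpa using hp.mul h1

theorem contDiff_of_mem_polyFun {f : G → ℝ} (hf : f ∈ polyFun G) : ContDiff ℝ ∞ f := by
  obtain ⟨p, rfl⟩ := mem_polyFun_iff.1 hf
  exact contDiff_eval_coord p

/-- Induction on the degree: if some partial derivative of `p` is a nonzero polynomial, a zero of
`p` is either a zero of that derivative, which has lower degree, or a regular point of the level
set. Otherwise `p` is a nonzero constant. -/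
theorem isThinRel_eval_coord_eq_zero (p : MvPolynomial (Fin (finrank ℝ G)) ℝ) (hp : p ≠ 0) :
    IsThinRel {x : G | MvPolynomial.eval (fun i => (finBasis ℝ G).coord i x) p = 0}
      (finrank ℝ G) := by
  induction hn : p.totalDegree using Nat.strong_induction_on generalizing p with
  | _ n ih =>
    by_cases hc : ∀ i, MvPolynomial.pderiv i p = 0
    · have h1 := MvPolynomial.eq_C_of_pderiv_eq_zero hc
      have h2 : MvPolynomial.coeff 0 p ≠ 0 := by
        intro h0
        rw [h0, map_zero] at h1
        exact hp h1
      rw [h1]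
      simpa [h2] using isThinRel_empty (E := G) _
    · push Not at hc
      obtain ⟨i, hi⟩ := hc
      have h1 := ih _ (hn ▸ MvPolynomial.totalDegree_pderiv_lt i hi) _ hi rfl
      have hd : ∀ x : G,
          fderiv ℝ (fun x => MvPolynomial.eval (fun i => (finBasis ℝ G).coord i x) p) x
            (finBasis ℝ G i) =
          MvPolynomial.eval (fun i => (finBasis ℝ G).coord i x) (MvPolynomial.pderiv i p) := by
        intro x
        rw [(hasFDerivAt_eval_coord p x).fderiv]
        simp [Finsupp.single_apply]
      -- The index `i` shows that the dimension is positive, so the truncated subtraction of one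
      -- really lowers it.
      have h2 := (isSmoothSubmanifold_level (contDiff_eval_coord p) (finBasis ℝ G i)).isThinRel
        (D := finrank ℝ G) (Nat.sub_lt i.pos one_pos)
      refine (h1.union h2).mono fun x hx => ?_
      by_cases hx' : MvPolynomial.eval (fun i => (finBasis ℝ G).coord i x)
        (MvPolynomial.pderiv i p) = 0
      · exact Or.inl hx'
      · exact Or.inr ⟨hx, by rw [hd]; exact hx'⟩

theorem isThinRel_zeros_of_mem_polyFun {f : G → ℝ} (hf : f ∈ polyFun G) {x : G} (hx : f x ≠ 0) :
    IsThinRel {x : G | f x = 0} (finrank ℝ G) := by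
  obtain ⟨p, rfl⟩ := mem_polyFun_iff.1 hf
  refine isThinRel_eval_coord_eq_zero p ?_
  rintro rfl
  simp at hx

/-- By the identity theorem for analytic functions, a polynomial vanishing near one point vanishes
everywhere. -/
theorem dense_ne_zero_of_mem_polyFun {f : G → ℝ} (hf : f ∈ polyFun G) {x : G} (hx : f x ≠ 0) :
    Dense {x : G | f x ≠ 0} := by
  obtain ⟨p, rfl⟩ := mem_polyFun_iff.1 hf
  have han := AnalyticOnNhd.eval_continuousLinearMap' (𝕜 := ℝ)
    (fun i => LinearMap.toContinuousLinearMap ((finBasis ℝ G).coord i)) p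
  intro y
  by_contra hy
  rw [mem_closure_iff_frequently, Filter.not_frequently] at hy
  have hy' : (fun x => MvPolynomial.eval (fun i => (finBasis ℝ G).coord i x) p)
      =ᶠ[nhds y] fun _ => 0 := hy.mono fun z hz => not_not.1 hz
  have := han.eq_of_eventuallyEq analyticOnNhd_const hy'
  exact hx (congrFun this x)

theorem mem_closure_of_mem_polyFun {E : Type*} [NormedAddCommGroup E] [NormedSpace ℝ E]
    {f : G → ℝ} (hf : f ∈ polyFun G) {x : G} (hx : f x ≠ 0) {g : G → E} (hg : ContDiff ℝ ∞ g)
    {S : Set E} (hS : ∀ y, f y ≠ 0 → g y ∈ S) (y : G) : g y ∈ closure S :=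
  map_mem_closure hg.continuous (dense_ne_zero_of_mem_polyFun hf hx y) hS

/-- Complex-valued functions whose real and imaginary parts are real polynomials. -/
def complexPolyFun (G : Type*) [NormedAddCommGroup G] [NormedSpace ℝ G] [FiniteDimensional ℝ G] :
    Subring (G → ℂ) where
  carrier := {f | (fun x => (f x).re) ∈ polyFun G ∧ (fun x => (f x).im) ∈ polyFun G}
  mul_mem' hf hg :=
    ⟨Subalgebra.sub_mem _ (Subalgebra.mul_mem _ hf.1 hg.1) (Subalgebra.mul_mem _ hf.2 hg.2),
      Subalgebra.add_mem _ (Subalgebra.mul_mem _ hf.1 hg.2) (Subalgebra.mul_mem _ hf.2 hg.1)⟩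
  one_mem' := ⟨Subalgebra.one_mem _, Subalgebra.zero_mem _⟩
  add_mem' hf hg := ⟨Subalgebra.add_mem _ hf.1 hg.1, Subalgebra.add_mem _ hf.2 hg.2⟩
  zero_mem' := ⟨Subalgebra.zero_mem _, Subalgebra.zero_mem _⟩
  neg_mem' hf := ⟨Subalgebra.neg_mem _ hf.1, Subalgebra.neg_mem _ hf.2⟩

theorem star_mem_complexPolyFun {f : G → ℂ} (hf : f ∈ complexPolyFun G) :
    (fun x => star (f x)) ∈ complexPolyFun G :=
  ⟨hf.1, Subalgebra.neg_mem _ hf.2⟩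

theorem linearMap_mem_complexPolyFun (l : G →ₗ[ℝ] ℂ) : (l : G → ℂ) ∈ complexPolyFun G :=
  ⟨linearMap_mem_polyFun (Complex.reLm ∘ₗ l), linearMap_mem_polyFun (Complex.imLm ∘ₗ l)⟩

/-- A matrix-valued function all of whose entries are polynomial. -/
def IsMatrixPoly {m n : Type*} (A : G → Matrix m n ℂ) : Prop :=
  ∀ i j, (fun x => A x i j) ∈ complexPolyFun G

namespace IsMatrixPoly

variable {m n o l : Type*}

theorem mul [Fintype n] {A : G → Matrix m n ℂ} {B : G → Matrix n o ℂ} (hA : IsMatrixPoly A)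
    (hB : IsMatrixPoly B) : IsMatrixPoly fun x => A x * B x := by
  intro i j
  have : (fun x => (A x * B x) i j) = ∑ k, (fun x => A x i k) * fun x => B x k j := by
    ext x; simp [Matrix.mul_apply]
  rw [this]
  exact Subring.sum_mem _ fun k _ => Subring.mul_mem _ (hA i k) (hB k j)

theorem conjTranspose {A : G → Matrix m n ℂ} (hA : IsMatrixPoly A) :
    IsMatrixPoly fun x => (A x).conjTranspose :=
  fun i j => star_mem_complexPolyFun (hA j i)

theorem pow [Fintype m] [DecidableEq m] {A : G → Matrix m m ℂ} (hA : IsMatrixPoly A) (r : ℕ) :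
    IsMatrixPoly fun x => A x ^ r := by
  induction r with
  | zero =>
    intro i j
    simp only [pow_zero, Matrix.one_apply]
    split_ifs
    · exact Subring.one_mem _
    · exact Subring.zero_mem _
  | succ r ih => simp only [pow_succ]; exact ih.mul hA

theorem trace [Fintype m] {A : G → Matrix m m ℂ} (hA : IsMatrixPoly A) :
    (fun x => (A x).trace) ∈ complexPolyFun G := by
  have : (fun x => (A x).trace) = ∑ i, fun x => A x i i := by ext x; simp [Matrix.trace]
  rw [this]
  exact Subring.sum_mem _ fun i _ => hA i i

theorem of_isLinearMap {A : G → Matrix m n ℂ} (hA : IsLinearMap ℝ A) : IsMatrixPoly A :=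
  fun i j => linearMap_mem_complexPolyFun (Matrix.entryLinearMap ℝ ℂ i j ∘ₗ hA.mk' A)

end IsMatrixPoly

theorem det_mem_polyFun {m : Type*} [Fintype m] [DecidableEq m] {A : G → Matrix m m ℝ}
    (hA : ∀ i j, (fun x => A x i j) ∈ polyFun G) : (fun x => (A x).det) ∈ polyFun G := by
  have : (fun x => (A x).det) =
      ∑ σ : Equiv.Perm m, (Equiv.Perm.sign σ : ℤ) • ∏ i, fun x => A x (σ i) i := by
    ext x
    simp [Matrix.det_apply, Units.smul_def]
  rw [this]
  exact Subalgebra.sum_mem _ fun σ _ => zsmul_mem (Subalgebra.prod_mem _ fun i _ => hA _ _) _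

end PolynomialFunctions

/-! ### Distinct singular values as nonvanishing of a Hankel determinant -/

section SingularValues

open Matrix Module

/-- The Hankel determinant of the power sums `tr (A* A) ^ m`, `m = 1, …, 2k - 1`. -/
noncomputable def hankelDet {n : Type*} [Fintype n] [DecidableEq n] (k : ℕ) (A : Matrix n n ℂ) :
    ℝ :=
  (Matrix.of fun i j : Fin k => ((Aᴴ * A) ^ ((i : ℕ) + j + 1)).trace.re).det

/-- The Hankel matrix of power sums factors as `Vᵀ diag(s) V` with `V` the Vandermonde matrix of
`s`. -/
theorem hankelDet_ne_zero_iff {n : Type*} [Fintype n] [DecidableEq n] {k : ℕ} {A : Matrix n n ℂ}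
    {s : Fin k → ℝ} (h : ∀ m : ℕ, ((Aᴴ * A) ^ (m + 1)).trace.re = ∑ i, s i ^ (m + 1)) :
    hankelDet k A ≠ 0 ↔ Function.Injective s ∧ ∀ i, s i ≠ 0 := by
  have : (Matrix.of fun i j : Fin k => ((Aᴴ * A) ^ ((i : ℕ) + j + 1)).trace.re) =
      (vandermonde s)ᵀ * (diagonal s * vandermonde s) := by
    ext i j
    rw [of_apply, h, mul_apply]
    refine Finset.sum_congr rfl fun l _ => ?_
    rw [diagonal_mul, transpose_apply, vandermonde_apply, vandermonde_apply]
    ring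
  rw [hankelDet, this, det_mul, det_mul, det_transpose, det_diagonal, mul_ne_zero_iff,
    mul_ne_zero_iff, det_vandermonde_ne_zero_iff, Finset.prod_ne_zero_iff]
  simp only [Finset.mem_univ, forall_const]
  tauto

theorem rank_eq_finrank_range_toEuclideanLin {m n : Type*} [Fintype m] [Fintype n] [DecidableEq n]
    (A : Matrix m n ℂ) : A.rank = finrank ℂ (Matrix.toEuclideanLin A).range := by
  classical
  rw [toEuclideanLin, toLpLin_eq_toLin, ← rank_eq_finrank_range_toLin]

/-- The operator of `Aᴴ * A` is diagonal in an orthonormal eigenbasis, with the squared singular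
values as eigenvalues. -/
theorem trace_pow_eq_sum_singVal {N k : ℕ} (hk : k ≤ N) {A : Matrix (Fin N) (Fin N) ℂ}
    (hA : A.rank ≤ k) (m : ℕ) :
    ((Aᴴ * A) ^ (m + 1)).trace.re = ∑ i : Fin k, (singVal A i ^ 2) ^ (m + 1) := by
  set T := toEuclideanLin A with hT
  have hn : finrank ℂ (EuclideanSpace ℂ (Fin N)) = N := by simp
  have hS := T.isSymmetric_adjoint_comp_self
  have h1 : toEuclideanLin (Aᴴ * A) = T.adjoint ∘ₗ T := by
    rw [toLpLin_mul_same, toEuclideanLin_conjTranspose_eq_adjoint]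
  have h2 : ((Aᴴ * A) ^ (m + 1)).trace =
      LinearMap.trace ℂ _ ((T.adjoint ∘ₗ T) ^ (m + 1)) := by
    rw [← h1, ← toLpLin_pow, toLpLin_eq_toLin,
      LinearMap.trace_eq_matrix_trace ℂ (PiLp.basisFun 2 ℂ (Fin N)), LinearMap.toMatrix_toLin]
  have h3 : ∀ r : ℕ, ∀ i, ((T.adjoint ∘ₗ T) ^ r) (hS.eigenvectorBasis hn i) =
      ((hS.eigenvalues hn i : ℂ) ^ r) • hS.eigenvectorBasis hn i := by
    intro r i
    induction r with
    | zero => simp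
    | succ r ih =>
      rw [pow_succ', Module.End.mul_apply, ih, map_smul, hS.apply_eigenvectorBasis hn, smul_smul,
        pow_succ]
      rfl
  have h4 : ((Aᴴ * A) ^ (m + 1)).trace.re = ∑ i : Fin N, (singVal A i ^ 2) ^ (m + 1) := by
    rw [h2, LinearMap.trace_eq_sum_inner _ (hS.eigenvectorBasis hn), Complex.re_sum]
    refine Finset.sum_congr rfl fun i _ => ?_
    rw [h3, inner_smul_right, inner_self_eq_norm_sq_to_K, (hS.eigenvectorBasis hn).norm_eq_one,
      singVal, ← hT, T.sq_singularValues_fin hn]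
    simp [← Complex.ofReal_pow]
  rw [h4, Fin.sum_univ_eq_sum_range (fun i => (singVal A i ^ 2) ^ (m + 1)),
    Fin.sum_univ_eq_sum_range (fun i => (singVal A i ^ 2) ^ (m + 1))]
  -- Singular values beyond the rank vanish, and contribute nothing because the exponent `m + 1` is
  -- positive.
  refine (Finset.sum_subset (Finset.range_subset_range.2 hk) fun i _ hi => ?_).symm
  have : singVal A i = 0 := by
    rw [singVal, LinearMap.singularValues_eq_zero_iff_le_finrank_range,
      ← rank_eq_finrank_range_toEuclideanLin]
    exact hA.trans (by simpa using hi)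
  rw [this]
  simp

/-- Singular values are nonnegative and already in decreasing order, so strict decrease amounts to
injectivity of their squares. -/
theorem mem_rankDistinct_iff {N k : ℕ} (hk : k ≤ N) {A : Matrix (Fin N) (Fin N) ℂ} :
    A ∈ rankDistinct N k ↔ A.rank ≤ k ∧ hankelDet k A ≠ 0 := by
  refine and_congr_right fun hA => ?_
  have hA : A.rank ≤ k := hA
  have h0 : ∀ i, 0 ≤ singVal A i := (toEuclideanLin A).singularValues_nonneg
  have hanti : Antitone (singVal A) := (toEuclideanLin A).singularValues_antitone
  rw [hankelDet_ne_zero_iff (trace_pow_eq_sum_singVal hk hA)]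
  constructor
  · rintro ⟨hlt, hpos⟩
    refine ⟨fun i j hij => ?_, fun i => pow_ne_zero _ (hpos i i.2).ne'⟩
    have hij : singVal A i = singVal A j := by
      rwa [sq_eq_sq₀ (h0 _) (h0 _)] at hij
    rcases lt_trichotomy i j with h | h | h
    · exact absurd hij (hlt i j h j.2).ne'
    · exact h
    · exact absurd hij (hlt j i h i.2).ne
  · rintro ⟨hinj, hpos⟩
    refine ⟨fun i j hij hj => ?_, fun i hi => ?_⟩
    · refine lt_of_le_of_ne (hanti hij.le) fun h => hij.ne ?_
      have := @hinj ⟨i, hij.trans hj⟩ ⟨j, hj⟩ (by simp only [h])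
      exact congrArg Fin.val this
    · exact lt_of_le_of_ne (h0 i) fun h => hpos ⟨i, hi⟩ (by simp [← h])

theorem rank_of_mem_rankDistinct {N k : ℕ} {A : Matrix (Fin N) (Fin N) ℂ}
    (hA : A ∈ rankDistinct N k) : A.rank = k := by
  refine le_antisymm hA.1 ?_
  by_contra! h
  have := hA.2.2 _ h
  rw [singVal, LinearMap.singularValues_pos_iff_lt_finrank_range,
    ← rank_eq_finrank_range_toEuclideanLin] at this
  exact lt_irrefl _ this

/-- An explicit matrix with nonzero singular values `1, …, k`; it ensures that the polynomials used
for density and thinness are not identically zero. -/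
theorem hankelDet_fromBlocks_diagonal_ne_zero {n m : Type*} [Fintype n] [DecidableEq n] [Fintype m]
    [DecidableEq m] {k : ℕ} (e e' : n ≃ Fin k ⊕ m) :
    hankelDet k ((fromBlocks (diagonal fun i : Fin k => ((i : ℕ) + 1 : ℂ)) 0 0 0).submatrix e e')
      ≠ 0 := by
  set d : Fin k → ℝ := fun i => ((i : ℕ) + 1) ^ 2
  refine (hankelDet_ne_zero_iff (s := d) fun r => ?_).2 ⟨fun i j hij => ?_, fun i => ?_⟩
  · have h1 : ∀ r : ℕ, (fromBlocks (diagonal fun i => (d i : ℂ)) 0 0 (0 : Matrix m m ℂ)) ^ (r + 1) =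
        fromBlocks (diagonal fun i => (d i : ℂ) ^ (r + 1)) 0 0 0 := by
      intro r
      induction r with
      | zero => simp
      | succ r ih =>
        rw [pow_succ, ih, fromBlocks_multiply]
        simp [pow_succ]
    have h2 : ∀ (B : Matrix (Fin k ⊕ m) (Fin k ⊕ m) ℂ) (r : ℕ),
        (B.submatrix e' e') ^ r = (B ^ r).submatrix e' e' := by
      intro B r
      exact (map_pow (reindexAlgEquiv ℂ ℂ e'.symm) B r).symm
    rw [conjTranspose_submatrix, submatrix_mul_equiv, fromBlocks_conjTranspose,
      fromBlocks_multiply, h2]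
    simp only [diagonal_conjTranspose, diagonal_mul_diagonal, conjTranspose_zero,
      Matrix.mul_zero, add_zero, Matrix.zero_mul]
    have h3 : (fun i : Fin k => star (fun i : Fin k => ((i : ℕ) + 1 : ℂ)) i * ((i : ℕ) + 1 : ℂ)) =
        fun i => (d i : ℂ) := by
      ext i
      simp [d, sq]
    rw [h3, h1]
    have h4 : ∀ B : Matrix (Fin k ⊕ m) (Fin k ⊕ m) ℂ, (B.submatrix e' e').trace = B.trace :=
      fun B => e'.sum_comp fun i => B i i
    rw [h4]
    simp [trace, ← Complex.ofReal_pow]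
  · have : ((i : ℕ) + 1 : ℝ) = (j : ℕ) + 1 := by
      rwa [sq_eq_sq₀ (by positivity) (by positivity)] at hij
    exact Fin.ext (by exact_mod_cast add_right_cancel this)
  · positivity

theorem hankelDet_mem_polyFun {G : Type*} [NormedAddCommGroup G] [NormedSpace ℝ G]
    [FiniteDimensional ℝ G] {n : Type*} [Fintype n] [DecidableEq n] (k : ℕ)
    {A : G → Matrix n n ℂ} (hA : IsMatrixPoly A) : (fun x => hankelDet k (A x)) ∈ polyFun G :=
  det_mem_polyFun fun i j => ((hA.conjTranspose.mul hA).pow ((i : ℕ) + j + 1)).trace.1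

end SingularValues

/-! ### Smoothness of matrix operations -/

section MatrixSmooth

open Matrix Module

variable {E : Type*} [NormedAddCommGroup E] [NormedSpace ℝ E] {m n o : Type*} [Fintype m]
  [Fintype n] [Fintype o]

theorem contDiffOn_matrix {f : E → Matrix m n ℂ} {s : Set E}
    (h : ∀ i j, ContDiffOn ℝ ∞ (fun x => f x i j) s) : ContDiffOn ℝ ∞ f s := by
  have h1 : ContDiffOn ℝ ∞ (fun x => (fun i j => f x i j : m → n → ℂ)) s :=
    contDiffOn_pi.2 fun i => contDiffOn_pi.2 fun j => h i j
  let L : (m → n → ℂ) →ₗ[ℝ] Matrix m n ℂ := (Matrix.ofLinearEquiv ℝ).toLinearMap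
  exact (LinearMap.toContinuousLinearMap L).contDiff.comp_contDiffOn h1

theorem ContDiffOn.matrix_apply {f : E → Matrix m n ℂ} {s : Set E} (h : ContDiffOn ℝ ∞ f s)
    (i : m) (j : n) : ContDiffOn ℝ ∞ (fun x => f x i j) s := by
  let L : Matrix m n ℂ →ₗ[ℝ] ℂ := Matrix.entryLinearMap ℝ ℂ i j
  exact (LinearMap.toContinuousLinearMap L).contDiff.comp_contDiffOn h

theorem ContDiffOn.matrix_mul {f : E → Matrix m n ℂ} {g : E → Matrix n o ℂ} {s : Set E}
    (hf : ContDiffOn ℝ ∞ f s) (hg : ContDiffOn ℝ ∞ g s) :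
    ContDiffOn ℝ ∞ (fun x => f x * g x) s := by
  refine contDiffOn_matrix fun i j => ?_
  simp only [mul_apply]
  exact ContDiffOn.sum fun k _ => (hf.matrix_apply i k).mul (hg.matrix_apply k j)

theorem ContDiffOn.matrix_det [DecidableEq n] {f : E → Matrix n n ℂ} {s : Set E}
    (hf : ContDiffOn ℝ ∞ f s) : ContDiffOn ℝ ∞ (fun x => (f x).det) s := by
  simp only [det_apply]
  exact ContDiffOn.sum fun σ _ => (contDiffOn_prod fun i _ => hf.matrix_apply _ _).const_smul _

/-- Cramer's rule: the inverse is the adjugate divided by the determinant. -/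
theorem ContDiffOn.matrix_inv [DecidableEq n] {f : E → Matrix n n ℂ} {s : Set E}
    (hf : ContDiffOn ℝ ∞ f s) (h0 : ∀ x ∈ s, (f x).det ≠ 0) :
    ContDiffOn ℝ ∞ (fun x => (f x)⁻¹) s := by
  refine contDiffOn_matrix fun i j => ?_
  simp only [inv_def, Matrix.smul_apply, Ring.inverse_eq_inv', smul_eq_mul, adjugate_apply]
  refine (hf.matrix_det.inv h0).mul (ContDiffOn.matrix_det (contDiffOn_matrix fun a b => ?_))
  simp only [updateRow_apply]
  split_ifs
  · exact contDiffOn_const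
  · exact hf.matrix_apply a b

theorem ContDiffOn.matrix_submatrix {m' n' : Type*} [Fintype m'] [Fintype n']
    {f : E → Matrix m n ℂ} {s : Set E} (hf : ContDiffOn ℝ ∞ f s) (r : m' → m) (c : n' → n) :
    ContDiffOn ℝ ∞ (fun x => (f x).submatrix r c) s :=
  contDiffOn_matrix fun i j => hf.matrix_apply (r i) (c j)

end MatrixSmooth

/-! ### Schur complement coordinates -/

section SchurChart

open Matrix Module

/-- Block coordinates `(X, Y, Z)` of the matrices `[X, XZ; YX, YXZ]`. -/
abbrev BlockCoord (k m : ℕ) : Type :=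
  Matrix (Fin k) (Fin k) ℂ × Matrix (Fin m) (Fin k) ℂ × Matrix (Fin k) (Fin m) ℂ

variable {k m : ℕ} {n : Type*}

theorem finrank_real_matrix (a b : Type*) [Fintype a] [Fintype b] :
    finrank ℝ (Matrix a b ℂ) = 2 * (Fintype.card a * Fintype.card b) := by
  rw [finrank_real_of_complex, finrank_matrix, finrank_self, mul_one]

theorem finrank_blockCoord (k m : ℕ) :
    finrank ℝ (BlockCoord k m) = 2 * (k * k + 2 * (m * k)) := by
  simp only [BlockCoord, finrank_prod, finrank_real_matrix, Fintype.card_fin]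
  ring

variable (e e' : n ≃ Fin k ⊕ Fin m)

/-- Rows and columns are reordered along `e` and `e'`, and the matrix `[X, B; C, D]` is sent to
`(X, C X⁻¹, X⁻¹ B, D - C X⁻¹ B)`. -/
noncomputable def schurCoord (A : Matrix n n ℂ) : BlockCoord k m × Matrix (Fin m) (Fin m) ℂ :=
  let X := A.submatrix (e.symm ∘ Sum.inl) (e'.symm ∘ Sum.inl)
  let B := A.submatrix (e.symm ∘ Sum.inl) (e'.symm ∘ Sum.inr)
  let C := A.submatrix (e.symm ∘ Sum.inr) (e'.symm ∘ Sum.inl)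
  let D := A.submatrix (e.symm ∘ Sum.inr) (e'.symm ∘ Sum.inr)
  ((X, C * X⁻¹, X⁻¹ * B), D - C * X⁻¹ * B)

/-- The inverse of `schurCoord`. -/
noncomputable def schurParam (x : BlockCoord k m × Matrix (Fin m) (Fin m) ℂ) : Matrix n n ℂ :=
  (fromBlocks x.1.1 (x.1.1 * x.1.2.2) (x.1.2.1 * x.1.1)
    (x.1.2.1 * x.1.1 * x.1.2.2 + x.2)).submatrix e e'

theorem schurParam_schurCoord {A : Matrix n n ℂ}
    (hA : (A.submatrix (e.symm ∘ Sum.inl) (e'.symm ∘ Sum.inl)).det ≠ 0) :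
    schurParam e e' (schurCoord e e' A) = A := by
  have hu := isUnit_iff_ne_zero.2 hA
  simp only [schurParam, schurCoord]
  set X := A.submatrix (e.symm ∘ Sum.inl) (e'.symm ∘ Sum.inl)
  rw [mul_nonsing_inv_cancel_left _ _ hu, nonsing_inv_mul_cancel_right _ _ hu,
    ← Matrix.mul_assoc, add_sub_cancel]
  have : fromBlocks X (A.submatrix (e.symm ∘ Sum.inl) (e'.symm ∘ Sum.inr))
      (A.submatrix (e.symm ∘ Sum.inr) (e'.symm ∘ Sum.inl))
      (A.submatrix (e.symm ∘ Sum.inr) (e'.symm ∘ Sum.inr)) = A.submatrix e.symm e'.symm := by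
    ext (i | i) (j | j) <;> rfl
  rw [this]
  simp

theorem schurCoord_schurParam {x : BlockCoord k m × Matrix (Fin m) (Fin m) ℂ}
    (hx : x.1.1.det ≠ 0) : schurCoord e e' (schurParam e e' x) = x := by
  obtain ⟨⟨X, Y, Z⟩, S⟩ := x
  have hu : IsUnit X.det := isUnit_iff_ne_zero.2 hx
  have h1 : ∀ (M : Matrix (Fin k ⊕ Fin m) (Fin k ⊕ Fin m) ℂ) {a b : Type}
      (r : a → Fin k ⊕ Fin m) (c : b → Fin k ⊕ Fin m),
      (M.submatrix e e').submatrix (e.symm ∘ r) (e'.symm ∘ c) = M.submatrix r c := by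
    intro M a b r c
    ext i j
    simp
  have h11 : (fromBlocks X (X * Z) (Y * X) (Y * X * Z + S)).submatrix Sum.inl Sum.inl = X := rfl
  have h12 : (fromBlocks X (X * Z) (Y * X) (Y * X * Z + S)).submatrix Sum.inl Sum.inr = X * Z :=
    rfl
  have h21 : (fromBlocks X (X * Z) (Y * X) (Y * X * Z + S)).submatrix Sum.inr Sum.inl = Y * X :=
    rfl
  have h22 : (fromBlocks X (X * Z) (Y * X) (Y * X * Z + S)).submatrix Sum.inr Sum.inr =
      Y * X * Z + S := rfl
  simp only [schurParam, schurCoord, h1, h11, h12, h21, h22]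
  rw [nonsing_inv_mul_cancel_left _ _ hu, mul_nonsing_inv_cancel_right _ _ hu, ← Matrix.mul_assoc,
    add_sub_cancel_left]

theorem contDiff_fst_fst_det :
    ContDiff ℝ ∞ fun x : BlockCoord k m × Matrix (Fin m) (Fin m) ℂ => x.1.1.det := by
  rw [← contDiffOn_univ]
  exact ContDiffOn.matrix_det (contDiff_fst.comp contDiff_fst).contDiffOn

theorem contDiff_submatrix_det [Fintype n] :
    ContDiff ℝ ∞ fun A : Matrix n n ℂ =>
      (A.submatrix (e.symm ∘ Sum.inl) (e'.symm ∘ Sum.inl)).det := by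
  rw [← contDiffOn_univ]
  exact (contDiffOn_id.matrix_submatrix _ _).matrix_det

theorem contDiffOn_schurCoord [Fintype n] : ContDiffOn ℝ ∞ (schurCoord e e')
    {A : Matrix n n ℂ | (A.submatrix (e.symm ∘ Sum.inl) (e'.symm ∘ Sum.inl)).det ≠ 0} := by
  have h1 : ∀ {a b : Type} [Fintype a] [Fintype b] (r : a → n) (c : b → n),
      ContDiffOn ℝ ∞ (fun A : Matrix n n ℂ => A.submatrix r c)
        {A | (A.submatrix (e.symm ∘ Sum.inl) (e'.symm ∘ Sum.inl)).det ≠ 0} :=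
    fun r c => contDiffOn_id.matrix_submatrix r c
  have h2 := (h1 (e.symm ∘ Sum.inl) (e'.symm ∘ Sum.inl)).matrix_inv fun x hx => hx
  exact ((h1 _ _).prodMk (((h1 _ _).matrix_mul h2).prodMk (h2.matrix_mul (h1 _ _)))).prodMk
    ((h1 _ _).sub (((h1 _ _).matrix_mul h2).matrix_mul (h1 _ _)))

theorem contDiff_schurParam [Fintype n] : ContDiff ℝ ∞ (schurParam (k := k) (m := m) e e') := by
  rw [← contDiffOn_univ]
  have hX : ContDiffOn ℝ ∞ (fun x : BlockCoord k m × Matrix (Fin m) (Fin m) ℂ => x.1.1) Set.univ :=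
    (contDiff_fst.comp contDiff_fst).contDiffOn
  have hY : ContDiffOn ℝ ∞ (fun x : BlockCoord k m × Matrix (Fin m) (Fin m) ℂ => x.1.2.1)
    Set.univ := (contDiff_fst.comp (contDiff_snd.comp contDiff_fst)).contDiffOn
  have hZ : ContDiffOn ℝ ∞ (fun x : BlockCoord k m × Matrix (Fin m) (Fin m) ℂ => x.1.2.2)
    Set.univ := (contDiff_snd.comp (contDiff_snd.comp contDiff_fst)).contDiffOn
  have hS : ContDiffOn ℝ ∞ (fun x : BlockCoord k m × Matrix (Fin m) (Fin m) ℂ => x.2)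
    Set.univ := contDiff_snd.contDiffOn
  refine ContDiffOn.matrix_submatrix (f := fun x : BlockCoord k m × Matrix (Fin m) (Fin m) ℂ =>
    fromBlocks x.1.1 (x.1.1 * x.1.2.2) (x.1.2.1 * x.1.1) (x.1.2.1 * x.1.1 * x.1.2.2 + x.2))
    (contDiffOn_matrix ?_) e e'
  rintro (i | i) (j | j)
  · exact hX.matrix_apply i j
  · exact (hX.matrix_mul hZ).matrix_apply i j
  · exact (hY.matrix_mul hX).matrix_apply i j
  · exact (((hY.matrix_mul hX).matrix_mul hZ).add hS).matrix_apply i j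

/-- The coordinates `schurCoord` as a diffeomorphism between open sets. -/
noncomputable def schurChart [Fintype n] :=
  openPartialHomeomorphOfContDiffOn (f := schurCoord e e') (g := schurParam e e')
    (contDiff_submatrix_det e e') contDiff_fst_fst_det (contDiffOn_schurCoord e e')
    (contDiff_schurParam e e').contDiffOn (fun _ hA => hA)
    (fun x hx => by
      have := congrArg (fun y => y.1.1) (schurCoord_schurParam e e' hx)
      change (schurCoord e e' (schurParam e e' x)).1.1.det ≠ 0
      rw [this]
      exact hx)
    (fun _ => schurParam_schurCoord e e') (fun _ => schurCoord_schurParam e e')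

end SchurChart

/-! ### Rank factorizations, nonzero minors and the Schur complement -/

section RankFactorization

open Matrix Module

/-- The map factors through its range, which embeds in `ℂ^k`; a left inverse of the embedding gives
`B`. -/
theorem Matrix.exists_mul_of_rank_le {m n : Type*} [Fintype m] [Fintype n] {k : ℕ}
    {A : Matrix m n ℂ} (hA : A.rank ≤ k) :
    ∃ (B : Matrix m (Fin k) ℂ) (C : Matrix (Fin k) n ℂ), A = B * C := by
  classical
  have h1 : finrank ℂ (LinearMap.range A.mulVecLin) ≤ finrank ℂ (Fin k → ℂ) := by
    rwa [finrank_fin_fun]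
  obtain ⟨i, hi⟩ := finrank_le_iff_exists_linearMap.1 h1
  obtain ⟨s, hs⟩ := i.exists_leftInverse_of_injective (LinearMap.ker_eq_bot.2 hi)
  refine ⟨LinearMap.toMatrix' ((LinearMap.range A.mulVecLin).subtype ∘ₗ s),
    LinearMap.toMatrix' (i ∘ₗ A.mulVecLin.rangeRestrict), ?_⟩
  rw [← LinearMap.toMatrix'_comp]
  have : ((LinearMap.range A.mulVecLin).subtype ∘ₗ s) ∘ₗ (i ∘ₗ A.mulVecLin.rangeRestrict) =
      A.mulVecLin := by
    ext1 v
    have := LinearMap.congr_fun hs (A.mulVecLin.rangeRestrict (Pi.single v 1))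
    ext1
    simp only [LinearMap.coe_comp, Function.comp_apply] at this ⊢
    rw [LinearMap.coe_single, this]
    rfl
  rw [this]
  exact (LinearMap.toMatrix'_toLin' A).symm

theorem Matrix.rank_mul_le_of_fin {m n : Type*} [Fintype n] [Fintype m] {k : ℕ}
    (B : Matrix m (Fin k) ℂ) (C : Matrix (Fin k) n ℂ) : (B * C).rank ≤ k :=
  (rank_mul_le_left B C).trans
    ((rank_le_card_width B).trans_eq (Fintype.card_fin k))

theorem Matrix.exists_linearIndependent_rows {m n : Type*} [Fintype m] [Fintype n] {k : ℕ}
    {A : Matrix m n ℂ} (hA : A.rank = k) :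
    ∃ r : Fin k → m, LinearIndependent ℂ (A.submatrix r id).row := by
  rw [rank_eq_finrank_span_row] at hA
  obtain ⟨f, hf, -, hli⟩   := Submodule.exists_fun_fin_finrank_span_eq ℂ (Set.range A.row)
  subst hA
  choose r hr using hf
  refine ⟨r, ?_⟩
  have : (A.submatrix r id).row = f := funext fun i => hr i
  rwa [this]

/-- Select `k` independent rows, then `k` independent columns of the resulting matrix, which still
has rank `k`. -/
theorem Matrix.exists_submatrix_det_ne_zero {m n : Type*} [Fintype m] [Fintype n] {k : ℕ}
    {A : Matrix m n ℂ} (hA : A.rank = k) :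
    ∃ (r : Fin k → m) (c : Fin k → n), (A.submatrix r c).det ≠ 0 := by
  obtain ⟨r, hr⟩ := exists_linearIndependent_rows hA
  have h1 : (A.submatrix r id)ᵀ.rank = k := by
    rw [rank_transpose, hr.rank_matrix, Fintype.card_fin]
  obtain ⟨c, hc⟩ := exists_linearIndependent_rows h1
  refine ⟨r, c, ?_⟩
  have h2 := (isUnit_iff_isUnit_det _).1 (linearIndependent_rows_iff_isUnit.1 hc)
  rw [← det_transpose]
  exact h2.ne_zero

theorem exists_equiv_sum_of_injective {k N : ℕ} {r : Fin k → Fin N}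
    (hr : Function.Injective r) :
    ∃ e : Fin N ≃ Fin k ⊕ Fin (N - k), e.symm ∘ Sum.inl = r := by
  classical
  have h1 : Fintype.card {x // x ∉ Set.range r} = N - k := by
    rw [Fintype.card_subtype_compl, Fintype.card_fin]
    congr 1
    exact (Set.card_range_of_injective hr).trans (Fintype.card_fin k)
  refine ⟨((Equiv.ofInjective r hr).sumCongr (Fintype.equivFinOfCardEq h1).symm |>.trans
    (Equiv.sumCompl (· ∈ Set.range r))).symm, ?_⟩
  ext i
  simp

theorem Matrix.exists_equiv_submatrix_det_ne_zero {N k : ℕ} {A : Matrix (Fin N) (Fin N) ℂ}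
    (hA : A.rank = k) : ∃ e e' : Fin N ≃ Fin k ⊕ Fin (N - k),
      (A.submatrix (e.symm ∘ Sum.inl) (e'.symm ∘ Sum.inl)).det ≠ 0 := by
  obtain ⟨r, c, h⟩ := exists_submatrix_det_ne_zero hA
  have hr : Function.Injective r := by
    intro i j hij
    by_contra hne
    exact h (det_zero_of_row_eq hne (funext fun l => by simp [hij]))
  have hc : Function.Injective c := by
    intro i j hij
    by_contra hne
    exact h (det_zero_of_column_eq hne fun l => by simp [hij])
  obtain ⟨e, he⟩ := exists_equiv_sum_of_injective hr
  obtain ⟨e', he'⟩ := exists_equiv_sum_of_injective hc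
  exact ⟨e, e', by rwa [he, he']⟩

/-- With zero Schur complement the matrix is `[X; YX]` times `[1, Z]`. Conversely, if `A = P Q` with
inner dimension `k`, then `X = P₁ Q₁` with both factors square and invertible, so `C X⁻¹ B = P₂ Q₁
(P₁ Q₁)⁻¹ P₁ Q₂ = P₂ Q₂ = D`. -/
theorem schurCoord_snd_eq_zero_iff {k m : ℕ} {n : Type*} [Fintype n] (e e' : n ≃ Fin k ⊕ Fin m)
    {A : Matrix n n ℂ} (hA : (A.submatrix (e.symm ∘ Sum.inl) (e'.symm ∘ Sum.inl)).det ≠ 0) :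
    (schurCoord e e' A).2 = 0 ↔ A.rank ≤ k := by
  constructor
  · intro h
    rw [← schurParam_schurCoord e e' hA, schurParam, h, add_zero]
    set x := (schurCoord e e' A).1
    have : fromBlocks x.1 (x.1 * x.2.2) (x.2.1 * x.1) (x.2.1 * x.1 * x.2.2) =
        fromRows x.1 (x.2.1 * x.1) * fromCols 1 x.2.2 := by
      rw [fromRows_mul_fromCols]
      simp
    rw [this, rank_submatrix]
    exact rank_mul_le_of_fin _ _
  · intro h
    obtain ⟨P, Q, rfl⟩ := exists_mul_of_rank_le h
    have h1 : ∀ {a b : Type} (r : a → n) (c : b → n),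
        (P * Q).submatrix r c = P.submatrix r id * Q.submatrix id c :=
      fun r c => submatrix_mul P Q r id c Function.bijective_id
    rw [h1, det_mul] at hA
    have hP := isUnit_iff_ne_zero.2 (left_ne_zero_of_mul hA)
    have hQ := isUnit_iff_ne_zero.2 (right_ne_zero_of_mul hA)
    simp only [schurCoord, h1]
    rw [Matrix.mul_inv_rev, Matrix.mul_assoc _ (_ * _) (_ * _), Matrix.mul_assoc _⁻¹ _⁻¹ (_ * _),
      nonsing_inv_mul_cancel_left _ _ hP, Matrix.mul_assoc, mul_nonsing_inv_cancel_left _ _ hQ,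
      sub_self]

end RankFactorization

/-! ### Smoothness, thinness and closure of the rank strata -/

section RankStrata

open Matrix Module

theorem isSmoothSubmanifold_univ {G : Type*} [NormedAddCommGroup G] [NormedSpace ℝ G]
    [FiniteDimensional ℝ G] : IsSmoothSubmanifold (Set.univ : Set G) (finrank ℝ G) :=
  fun _ _ => ⟨OpenPartialHomeomorph.refl G, ⊤, Set.mem_univ _, contDiffOn_id, contDiffOn_id,
    inferInstance, finrank_top ℝ G, fun _ _ => Iff.rfl⟩

theorem contDiffOn_schurChart {k m : ℕ} {n : Type*} [Fintype n] (e e' : n ≃ Fin k ⊕ Fin m) :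
    ContDiffOn ℝ ∞ (schurChart e e') (schurChart e e').source :=
  contDiffOn_schurCoord e e'

theorem contDiffOn_schurChart_symm {k m : ℕ} {n : Type*} [Fintype n]
    (e e' : n ≃ Fin k ⊕ Fin m) :
    ContDiffOn ℝ ∞ (schurChart e e').symm (schurChart e e').target :=
  (contDiff_schurParam e e').contDiffOn

theorem nonempty_linearEquiv_blockCoord {N k : ℕ} (hk : k ≤ N) :
    Nonempty ((BlockCoord k (N - k) × Matrix (Fin (N - k)) (Fin (N - k)) ℂ) ≃ₗ[ℝ]
      Matrix (Fin N) (Fin N) ℂ) := by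
  obtain ⟨m, rfl⟩ := Nat.exists_eq_add_of_le hk
  refine ⟨LinearEquiv.ofFinrankEq _ _ ?_⟩
  rw [finrank_prod, finrank_blockCoord, finrank_real_matrix, finrank_real_matrix]
  simp only [Fintype.card_fin, Nat.add_sub_cancel_left]
  ring

theorem finrank_blockCoord_eq {N k : ℕ} (hk : k ≤ N) :
    finrank ℝ (BlockCoord k (N - k)) = 2 * (2 * N * k - k ^ 2) := by
  obtain ⟨m, rfl⟩ := Nat.exists_eq_add_of_le hk
  rw [finrank_blockCoord, Nat.add_sub_cancel_left]
  congr 1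
  rw [eq_tsub_iff_add_eq_of_le (by nlinarith)]
  ring

/-- With `a = k - j` and `m = N - k`, the two dimensions differ by `2(a² + 2ma)`. -/
theorem rank_dimension_strictMono {N j k : ℕ} (hjk : j < k) (hk : k ≤ N) :
    2 * (2 * N * j - j ^ 2) < 2 * (2 * N * k - k ^ 2) := by
  rw [← finrank_blockCoord_eq (hjk.le.trans hk), ← finrank_blockCoord_eq hk, finrank_blockCoord,
    finrank_blockCoord]
  obtain ⟨m, rfl⟩ := Nat.exists_eq_add_of_le hk
  obtain ⟨c, rfl⟩ := Nat.exists_eq_add_of_lt hjk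
  rw [show j + c + 1 + m - j = c + 1 + m by omega,
    show j + c + 1 + m - (j + c + 1) = m by omega]
  nlinarith [Nat.zero_le (c * m), Nat.zero_le (c * c), Nat.zero_le (j * c)]

theorem isMatrixPoly_schurParam {k m : ℕ} {n : Type*} (e e' : n ≃ Fin k ⊕ Fin m) :
    IsMatrixPoly fun x : BlockCoord k m => schurParam e e' (x, 0) := by
  have hX : IsMatrixPoly fun x : BlockCoord k m => x.1 :=
    IsMatrixPoly.of_isLinearMap ⟨fun _ _ => rfl, fun _ _ => rfl⟩
  have hY : IsMatrixPoly fun x : BlockCoord k m => x.2.1 :=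
    IsMatrixPoly.of_isLinearMap ⟨fun _ _ => rfl, fun _ _ => rfl⟩
  have hZ : IsMatrixPoly fun x : BlockCoord k m => x.2.2 :=
    IsMatrixPoly.of_isLinearMap ⟨fun _ _ => rfl, fun _ _ => rfl⟩
  intro i j
  simp only [schurParam, submatrix_apply, add_zero]
  rcases e i with i | i <;> rcases e' j with j | j
  · exact hX i j
  · exact (hX.mul hZ) i j
  · exact (hY.mul hX) i j
  · exact ((hY.mul hX).mul hZ) i j

theorem exists_hankelDet_schurParam_ne_zero {k m : ℕ} {n : Type*} [Fintype n] [DecidableEq n]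
    (e e' : n ≃ Fin k ⊕ Fin m) :
    ∃ x : BlockCoord k m, hankelDet k (schurParam e e' (x, 0)) ≠ 0 := by
  refine ⟨(diagonal fun i : Fin k => ((i : ℕ) + 1 : ℂ), 0, 0), ?_⟩
  simpa [schurParam] using hankelDet_fromBlocks_diagonal_ne_zero e e'

theorem contDiff_hankelDet {n : Type*} [Fintype n] [DecidableEq n] (k : ℕ) :
    ContDiff ℝ ∞ (hankelDet k : Matrix n n ℂ → ℝ) :=
  contDiff_of_mem_polyFun (hankelDet_mem_polyFun k (IsMatrixPoly.of_isLinearMap ⟨fun _ _ => rfl, fun _ _ => rfl⟩))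

theorem isOpen_ne_zero_of_contDiff {E : Type*} [NormedAddCommGroup E] [NormedSpace ℝ E]
    {f : E → ℝ} (hf : ContDiff ℝ ∞ f) : IsOpen {x | f x ≠ 0} :=
  isOpen_ne_fun hf.continuous continuous_const

theorem isSmoothSubmanifold_rankDistinct {N k : ℕ} (hk : k ≤ N) :
    IsSmoothSubmanifold (rankDistinct N k) (2 * (2 * N * k - k ^ 2)) := by
  obtain ⟨L⟩ := nonempty_linearEquiv_blockCoord hk
  refine isSmoothSubmanifold_of_charts L fun p hp => ?_
  obtain ⟨e, e', he⟩ := exists_equiv_submatrix_det_ne_zero (rank_of_mem_rankDistinct hp)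
  -- On the open set where `hankelDet` is nonzero, membership reduces to the rank bound, hence to
  -- the linear slice.
  refine ⟨(schurChart e e').restrOpen _ (isOpen_ne_zero_of_contDiff (contDiff_hankelDet k)),
    LinearMap.range (LinearMap.inl ℝ _ _), ⟨he, ((mem_rankDistinct_iff hk).1 hp).2⟩,
    (contDiffOn_schurChart e e').mono Set.inter_subset_left,
    (contDiffOn_schurChart_symm e e').mono fun x hx => hx.1, inferInstance, ?_, ?_⟩
  · rw [LinearMap.finrank_range_of_inj LinearMap.inl_injective, finrank_blockCoord_eq hk]
  · rintro x ⟨hx, hx'⟩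
    rw [mem_rankDistinct_iff hk, ← schurCoord_snd_eq_zero_iff e e' hx, and_iff_left (show hankelDet k x ≠ 0 from hx'), LinearMap.range_inl]
    exact Iff.rfl

/-- The charts are indexed by ranks and by reorderings of rows and columns, so finitely many
suffice. -/
theorem isThinRel_rankAtMost_diff_rankDistinct {N k : ℕ} (hk : k ≤ N) :
    IsThinRel (rankAtMost N k \ rankDistinct N k) (2 * (2 * N * k - k ^ 2)) := by
  have h1 : ∀ j : Fin k, ∀ e : (Fin N ≃ Fin j ⊕ Fin (N - j)) × (Fin N ≃ Fin j ⊕ Fin (N - j)),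
      IsThinRel ((schurChart e.1 e.2).source ∩ schurChart e.1 e.2 ⁻¹' (Set.univ ×ˢ {0}))
        (2 * (2 * N * k - k ^ 2)) := by
    intro j e
    have hj : (j : ℕ) ≤ N := j.2.le.trans hk
    obtain ⟨L⟩ := nonempty_linearEquiv_blockCoord hj
    refine (isSmoothSubmanifold_univ.prod_zero.preimage L (schurChart e.1 e.2)
      (contDiffOn_schurChart _ _) (contDiffOn_schurChart_symm _ _)).isThinRel ?_
    rw [finrank_blockCoord_eq hj]
    exact rank_dimension_strictMono j.2 hk
  have h2 : ∀ e : (Fin N ≃ Fin k ⊕ Fin (N - k)) × (Fin N ≃ Fin k ⊕ Fin (N - k)),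
      IsThinRel ((schurChart e.1 e.2).source ∩ schurChart e.1 e.2 ⁻¹'
        ({x | hankelDet k (schurParam e.1 e.2 (x, 0)) = 0} ×ˢ {0}))
        (2 * (2 * N * k - k ^ 2)) := by
    intro e
    obtain ⟨L⟩ := nonempty_linearEquiv_blockCoord hk
    obtain ⟨x, hx⟩ := exists_hankelDet_schurParam_ne_zero e.1 e.2
    rw [← finrank_blockCoord_eq hk]
    exact ((isThinRel_zeros_of_mem_polyFun
      (hankelDet_mem_polyFun k (isMatrixPoly_schurParam e.1 e.2)) hx).prod_zero.preimage L
      (schurChart e.1 e.2) (contDiffOn_schurChart _ _) (contDiffOn_schurChart_symm _ _))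
  refine ((IsThinRel.iUnion fun j => IsThinRel.iUnion (h1 j)).union (IsThinRel.iUnion h2)).mono ?_
  rintro A ⟨hA, hA'⟩
  have hA : A.rank ≤ k := hA
  obtain ⟨e, e', he⟩ := exists_equiv_submatrix_det_ne_zero (A := A) rfl
  have h0 := (schurCoord_snd_eq_zero_iff e e' he).2 le_rfl
  rcases hA.lt_or_eq with hlt | heq
  · exact Or.inl (Set.mem_iUnion.2 ⟨⟨A.rank, hlt⟩,
      Set.mem_iUnion.2 ⟨(e, e'), he, Set.mem_univ _, h0⟩⟩)
  · subst heq
    refine Or.inr (Set.mem_iUnion.2 ⟨(e, e'), he, ?_, h0⟩)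
    have h3 : ((schurCoord e e' A).1, 0) = schurCoord e e' A := Prod.ext rfl h0.symm
    change hankelDet _ (schurParam e e' ((schurCoord e e' A).1, 0)) = 0
    rw [h3, schurParam_schurCoord e e' he]
    by_contra hne
    exact hA' ((mem_rankDistinct_iff hk).2 ⟨le_rfl, hne⟩)

/-- If `A` has rank above `k`, a nonzero minor of size `A.rank` stays nonzero nearby and excludes
rank at most `k`. -/
theorem isClosed_rankAtMost (N k : ℕ) : IsClosed (rankAtMost N k) := by
  rw [← isOpen_compl_iff, isOpen_iff_forall_mem_open]
  intro A hA
  have hA : k < A.rank := not_le.1 hA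
  obtain ⟨r, c, h⟩ := exists_submatrix_det_ne_zero (A := A) rfl
  refine ⟨{B | (B.submatrix r c).det ≠ 0}, fun B hB hBk => ?_,
    isOpen_ne_fun (continuous_id.matrix_submatrix r c).matrix_det continuous_const, h⟩
  obtain ⟨P, Q, rfl⟩ := exists_mul_of_rank_le hBk
  have h1 : ((P * Q).submatrix r c).rank ≤ k := by
    rw [submatrix_mul P Q r id c Function.bijective_id]
    exact rank_mul_le_of_fin _ _
  rw [rank_of_det_ne_zero hB, Fintype.card_fin] at h1
  exact hA.not_ge h1

theorem rankAtMost_eq_closure_rankDistinct {N k : ℕ} (hk : k ≤ N) :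
    rankAtMost N k = closure (rankDistinct N k) := by
  refine subset_antisymm (fun A hA => ?_)
    (closure_minimal (fun A hA => hA.1) (isClosed_rankAtMost N k))
  have hpoly : (fun x : Matrix (Fin N) (Fin k) ℂ × Matrix (Fin k) (Fin N) ℂ =>
      hankelDet k (x.1 * x.2)) ∈ polyFun _ :=
    hankelDet_mem_polyFun k ((IsMatrixPoly.of_isLinearMap ⟨fun _ _ => rfl, fun _ _ => rfl⟩).mul
      (IsMatrixPoly.of_isLinearMap ⟨fun _ _ => rfl, fun _ _ => rfl⟩))
  -- Any reordering would do: it only places the explicit example inside an `N × N` matrix, which is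
  -- then factored to give a point where the polynomial is nonzero.
  obtain ⟨e, -⟩ := exists_equiv_sum_of_injective (Fin.castLE_injective hk)
  obtain ⟨x₀, hx₀⟩ := exists_hankelDet_schurParam_ne_zero e e
  obtain ⟨B₀, C₀, h₀⟩ : ∃ (B : Matrix (Fin N) (Fin k) ℂ) (C : Matrix (Fin k) (Fin N) ℂ),
      schurParam e e (x₀, 0) = B * C := by
    refine ⟨(fromRows x₀.1 (x₀.2.1 * x₀.1)).submatrix e id, (fromCols 1 x₀.2.2).submatrix id e, ?_⟩
    rw [← submatrix_mul _ _ _ _ _ Function.bijective_id, fromRows_mul_fromCols]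
    simp [schurParam]
  obtain ⟨B, C, rfl⟩ := exists_mul_of_rank_le hA
  have hmul : ContDiff ℝ ∞ fun x : Matrix (Fin N) (Fin k) ℂ × Matrix (Fin k) (Fin N) ℂ =>
      x.1 * x.2 :=
    contDiffOn_univ.1 (contDiff_fst.contDiffOn.matrix_mul contDiff_snd.contDiffOn)
  exact mem_closure_of_mem_polyFun hpoly (x := (B₀, C₀)) (by rwa [← h₀]) hmul
    (fun x hx => (mem_rankDistinct_iff hk).2 ⟨rank_mul_le_of_fin _ _, hx⟩) (B, C)

end RankStrata

theorem proposition3 (N k : ℕ) (hk : k ≤ N) :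
    IsSmoothSubmanifold (rankDistinct N k) (2 * (2 * N * k - k ^ 2)) ∧
    rankAtMost N k = closure (rankDistinct N k) ∧
    IsThinRel (rankAtMost N k \ rankDistinct N k) (2 * (2 * N * k - k ^ 2)) :=
  ⟨isSmoothSubmanifold_rankDistinct hk, rankAtMost_eq_closure_rankDistinct hk,
    isThinRel_rankAtMost_diff_rankDistinct hk⟩
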